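/- Let $\Sigma$ be an alphabet with a converse operation $a\mapsto\bar a$ satisfying $\bar{\bar a}=a$, such that $\Sigma$ is partitioned into $\Sigma^+$ and $\Sigma^-$ with $a\in\Sigma^+$ iff $\bar a\in\Sigma^-$; for a word $u=a_1\cdots a_n$ put $\bar u=\bar a_n\cdots\bar a_1$. A semi-Thue system over $\Sigma$ is a set $S$ of rules $u\to v$ with $u,v\in\Sigma^*$; it is closed if $u\to v\in S$ implies $\bar u\to\bar v\in S$. Formulae are in negation normal form: $A::=p\mid\neg p\mid A\lor A\mid A\land A\mid[a]A\mid\langle a\rangle A$ with $a\in\Sigma$ and $p$ an atom; $\overline{A}$ denotes the negation normal form of $\neg A$. A nested sequent is a finite multiset of formulae and of structures $a\{\Delta\}$, where $a\in\Sigma$ and $\Delta$ is a nested sequent. The comma is multiset union. For $u=a_1\cdots a_n$ write $u\{\Delta\}$ for $a_1\{a_2\{\cdots a_n\{\Delta\}\cdots\}\}$, which is $\Delta$ when $n=0$. The calculus $\mathrm{SKm}(S)$ has the following rules (premises / conclusion), for all nested sequents $\Gamma,\Delta$, formulae $A,B$, atoms $p$ and labels $a\in\Sigma$: - id: no premise /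 $\Gamma,p,\neg p$; - cut: $\Gamma,A$ and $\Delta,\overline{A}$ / $\Gamma,\Delta$; - ctr: $\Gamma,\Delta,\Delta$ / $\Gamma,\Delta$; - wk: $\Gamma$ / $\Gamma,\Delta$; - r: $\Gamma,a\{\Delta\}$ / $\bar a\{\Gamma\},\Delta$; - $\land$: $\Gamma,A$ and $\Gamma,B$ / $\Gamma,A\land B$; - $\lor$: $\Gamma,A,B$ / $\Gamma,A\lor B$; - $[a]$: $\Gamma,a\{A\}$ / $\Gamma,[a]A$; - $\langle a\rangle$: $\Gamma,a\{\Delta,A\}$ / $\Gamma,a\{\Delta\},\langle a\rangle A$; - $\rho(S)$: $u\{\Delta\},\Gamma$ / $v\{\Delta\},\Gamma$, for each rule $u\to v\in S$. **Theorem (cut elimination).** For every closed semi-Thue system $S$, every nested sequent that is derivable in $\mathrm{SKm}(S)$ has a derivation in $\mathrm{SKm}(S)$ that does not use the cut rule. -/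

import Mathlib

namespace GrammarLogic

universe uL uA

/-- An alphabet of modality labels with a converse operation: an involution `conv` for which the
alphabet splits into two disjoint parts that are exchanged by `conv`. -/
class ConverseAlphabet (L : Type uL) where
  conv : L → L
  conv_conv : ∀ a : L, conv (conv a) = a
  exists_partition : ∃ P : Set L, ∀ a : L, a ∈ P ↔ conv a ∉ P

/-- The converse of a word: the converse of `a₁ a₂ … aₙ` is the word of the converses of
`aₙ, …, a₂, a₁`. -/
def convWord {L : Type uL} [ConverseAlphabet L] (u : List L) : List L :=
  (u.map ConverseAlphabet.conv).reverse

/-- A semi-Thue system over `L`: a set of production rules; `(u, v) ∈ S` stands for `u → v`. -/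
abbrev SemiThue (L : Type uL) : Type uL := Set (List L × List L)

/-- `S` is closed if it contains, with each rule `u → v`, the rule between the converse words. -/
def SemiThue.Closed {L : Type uL} [ConverseAlphabet L] (S : SemiThue L) : Prop :=
  ∀ u v : List L, (u, v) ∈ S → (convWord u, convWord v) ∈ S

/-- Multi-modal formulae in negation normal form, with atoms in `At` and labels in `L`. -/
inductive Formula (L : Type uL) (At : Type uA) : Type (max uL uA)
  | atom (p : At) : Formula L At
  | natom (p : At) : Formula L At
  | or (A B : Formula L At) : Formula L At
  | and (A B : Formula L At) : Formula L At
  | box (a : L) (A : Formula L At) : Formula L At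
  | dia (a : L) (A : Formula L At) : Formula L At

/-- The negation normal form of the negation of a formula. -/
def Formula.neg {L : Type uL} {At : Type uA} : Formula L At → Formula L At
  | .atom p => .natom p
  | .natom p => .atom p
  | .or A B => .and A.neg B.neg
  | .and A B => .or A.neg B.neg
  | .box a A => .dia a A.neg
  | .dia a A => .box a A.neg

/-- Terms that denote nested sequents: the empty sequent, one formula, one structure `a{Δ}`,
and the comma. -/
inductive PreSeq (L : Type uL) (At : Type uA) : Type (max uL uA)
  | empty : PreSeq L At
  | fml (A : Formula L At) : PreSeq L At
  | node (a : L) (X : PreSeq L At) : PreSeq L At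
  | comma (X Y : PreSeq L At) : PreSeq L At

/-- Two terms denote the same nested sequent: the least congruence for which the comma is
associative and commutative with the empty sequent as its unit. -/
inductive PreSeq.Same {L : Type uL} {At : Type uA} : PreSeq L At → PreSeq L At → Prop
  | refl (X : PreSeq L At) : PreSeq.Same X X
  | symm {X Y : PreSeq L At} : PreSeq.Same X Y → PreSeq.Same Y X
  | trans {X Y Z : PreSeq L At} : PreSeq.Same X Y → PreSeq.Same Y Z → PreSeq.Same X Z
  | comma {X X' Y Y' : PreSeq L At} :
      PreSeq.Same X X' → PreSeq.Same Y Y' → PreSeq.Same (.comma X Y) (.comma X' Y')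
  | node (a : L) {X X' : PreSeq L At} : PreSeq.Same X X' → PreSeq.Same (.node a X) (.node a X')
  | assoc (X Y Z : PreSeq L At) :
      PreSeq.Same (.comma (.comma X Y) Z) (.comma X (.comma Y Z))
  | comm (X Y : PreSeq L At) : PreSeq.Same (.comma X Y) (.comma Y X)
  | empty_comma (X : PreSeq L At) : PreSeq.Same (.comma .empty X) X

instance PreSeq.setoid (L : Type uL) (At : Type uA) : Setoid (PreSeq L At) where
  r := PreSeq.Same
  iseqv := ⟨PreSeq.Same.refl, PreSeq.Same.symm, PreSeq.Same.trans⟩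

/-- Nested sequents: finite multisets whose members are formulae and structures `a{Δ}`, where `a`
is a label and `Δ` is a nested sequent (see `NSeq.equivMultiset` below). -/
def NSeq (L : Type uL) (At : Type uA) : Type (max uL uA) := Quotient (PreSeq.setoid L At)

namespace NSeq

/-- The nested sequent that consists of one formula. -/
def fml {L : Type uL} {At : Type uA} (A : Formula L At) : NSeq L At :=
  Quotient.mk (PreSeq.setoid L At) (.fml A)

/-- The nested sequent that consists of the one structure `a{Δ}`. -/
def node {L : Type uL} {At : Type uA} (a : L) : NSeq L At → NSeq L At :=
  Quotient.map (PreSeq.node a) (fun _ _ h => PreSeq.Same.node a h)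

/-- The comma of two nested sequents is written `Γ + Δ`. -/
instance instAdd (L : Type uL) (At : Type uA) : Add (NSeq L At) where
  add := Quotient.map₂ PreSeq.comma (fun _ _ h _ _ h' => PreSeq.Same.comma h h')

/-- The empty nested sequent is written `0`. -/
instance instZero (L : Type uL) (At : Type uA) : Zero (NSeq L At) where
  zero := Quotient.mk (PreSeq.setoid L At) .empty

instance instAddCommMonoid (L : Type uL) (At : Type uA) : AddCommMonoid (NSeq L At) where
  add_assoc := by
    rintro ⟨X⟩ ⟨Y⟩ ⟨Z⟩
    exact Quotient.sound (PreSeq.Same.assoc X Y Z)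
  zero_add := by
    rintro ⟨X⟩
    exact Quotient.sound (PreSeq.Same.empty_comma X)
  add_zero := by
    rintro ⟨X⟩
    exact Quotient.sound ((PreSeq.Same.comm X .empty).trans (PreSeq.Same.empty_comma X))
  add_comm := by
    rintro ⟨X⟩ ⟨Y⟩
    exact Quotient.sound (PreSeq.Same.comm X Y)
  nsmul := nsmulRec

/-- A member of a nested sequent, as a nested sequent. -/
def item {L : Type uL} {At : Type uA} : Formula L At ⊕ (L × NSeq L At) → NSeq L At
  | .inl A => fml A
  | .inr x => node x.1 x.2

/-- The members of the nested sequent that a term denotes. -/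
def preMembers {L : Type uL} {At : Type uA} :
    PreSeq L At → Multiset (Formula L At ⊕ (L × NSeq L At))
  | .empty => 0
  | .fml A => {.inl A}
  | .node a X => {.inr (a, Quotient.mk (PreSeq.setoid L At) X)}
  | .comma X Y => preMembers X + preMembers Y

theorem preMembers_same {L : Type uL} {At : Type uA} {X Y : PreSeq L At} (h : PreSeq.Same X Y) :
    preMembers X = preMembers Y := by
  induction h with
  | refl => rfl
  | symm _ ih => exact ih.symm
  | trans _ _ ih ih' => exact ih.trans ih'
  | comma _ _ ih ih' => simp [preMembers, ih, ih']
  | node a h _ => simp only [preMembers]; rw [Quotient.sound h]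
  | assoc => simp [preMembers, add_assoc]
  | comm => simp [preMembers, add_comm]
  | empty_comma => simp [preMembers]

/-- The multiset of the members of a nested sequent. -/
def members {L : Type uL} {At : Type uA} :
    NSeq L At → Multiset (Formula L At ⊕ (L × NSeq L At)) :=
  Quotient.lift preMembers (fun _ _ h => preMembers_same h)

theorem members_add {L : Type uL} {At : Type uA} (Γ Δ : NSeq L At) :
    members (Γ + Δ) = members Γ + members Δ := by
  obtain ⟨X⟩ := Γ
  obtain ⟨Y⟩ := Δ
  rfl

theorem members_item {L : Type uL} {At : Type uA} (x : Formula L At ⊕ (L × NSeq L At)) :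
    members (item x) = {x} := by
  rcases x with A | ⟨a, ⟨X⟩⟩ <;> rfl

theorem sum_members {L : Type uL} {At : Type uA} (Γ : NSeq L At) :
    ((members Γ).map item).sum = Γ := by
  obtain ⟨X⟩ := Γ
  change ((preMembers X).map item).sum = Quotient.mk (PreSeq.setoid L At) X
  induction X with
  | empty => rfl
  | fml A => exact Multiset.sum_singleton _
  | node a X _ => exact Multiset.sum_singleton _
  | comma X Y ihX ihY => rw [preMembers, Multiset.map_add, Multiset.sum_add, ihX, ihY]; rfl

/-- Nested sequents are exactly the finite multisets of formulae and of structures `a{Δ}`. -/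
def equivMultiset (L : Type uL) (At : Type uA) :
    NSeq L At ≃ Multiset (Formula L At ⊕ (L × NSeq L At)) where
  toFun := members
  invFun m := (m.map item).sum
  left_inv := sum_members
  right_inv m := by
    change members ((m.map item).sum) = m
    induction m using Multiset.induction_on with
    | empty => rfl
    | cons x m ih => rw [Multiset.map_cons, Multiset.sum_cons, members_add, ih, members_item]; rfl

/-- The structure `u{Δ} = a₁{a₂{… aₙ{Δ} …}}` for a word `u = a₁ a₂ … aₙ`; it is `Δ` itself for the
empty word. -/
def nodeWord {L : Type uL} {At : Type uA} (u : List L) (Δ : NSeq L At) : NSeq L At :=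
  u.foldr node Δ

end NSeq

/-- Derivations in `SKm(S)`: the calculus `SKm` together with the structural rules `ρ(S)`. -/
inductive SKm {L : Type uL} [ConverseAlphabet L] {At : Type uA} (S : SemiThue L) :
    NSeq L At → Type (max uL uA)
  | id (Γ : NSeq L At) (p : At) :
      SKm S (Γ + NSeq.fml (.atom p) + NSeq.fml (.natom p))
  | cut (Γ Δ : NSeq L At) (A : Formula L At) :
      SKm S (Γ + NSeq.fml A) → SKm S (Δ + NSeq.fml A.neg) → SKm S (Γ + Δ)
  | ctr (Γ Δ : NSeq L At) : SKm S (Γ + Δ + Δ) → SKm S (Γ + Δ)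
  | wk (Γ Δ : NSeq L At) : SKm S Γ → SKm S (Γ + Δ)
  | res (Γ Δ : NSeq L At) (a : L) :
      SKm S (Γ + NSeq.node a Δ) →
        SKm S (NSeq.node (ConverseAlphabet.conv a) Γ + Δ)
  | and (Γ : NSeq L At) (A B : Formula L At) :
      SKm S (Γ + NSeq.fml A) → SKm S (Γ + NSeq.fml B) →
        SKm S (Γ + NSeq.fml (.and A B))
  | or (Γ : NSeq L At) (A B : Formula L At) :
      SKm S (Γ + NSeq.fml A + NSeq.fml B) → SKm S (Γ + NSeq.fml (.or A B))
  | box (Γ : NSeq L At) (a : L) (A : Formula L At) :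
      SKm S (Γ + NSeq.node a (NSeq.fml A)) → SKm S (Γ + NSeq.fml (.box a A))
  | dia (Γ Δ : NSeq L At) (a : L) (A : Formula L At) :
      SKm S (Γ + NSeq.node a (Δ + NSeq.fml A)) →
        SKm S (Γ + NSeq.node a Δ + NSeq.fml (.dia a A))
  | rho (Γ Δ : NSeq L At) (u v : List L) (h : (u, v) ∈ S) :
      SKm S (NSeq.nodeWord u Δ + Γ) → SKm S (NSeq.nodeWord v Δ + Γ)

/-- The derivation does not use the cut rule. -/
def SKm.CutFree {L : Type uL} [ConverseAlphabet L] {At : Type uA} {S : SemiThue L} :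
    {Γ : NSeq L At} → SKm S Γ → Prop
  | _, .id _ _ => True
  | _, .cut _ _ _ _ _ => False
  | _, .ctr _ _ d => d.CutFree
  | _, .wk _ _ d => d.CutFree
  | _, .res _ _ _ d => d.CutFree
  | _, .and _ _ _ d e => d.CutFree ∧ e.CutFree
  | _, .or _ _ _ d => d.CutFree
  | _, .box _ _ _ d => d.CutFree
  | _, .dia _ _ _ _ d => d.CutFree
  | _, .rho _ _ _ _ _ d => d.CutFree

end GrammarLogic

/-!
Cut elimination for `SKm(S)`, in the manner of Belnap's argument for display calculi.

Every rule is schematic in its structural parameters: if some occurrences of a formula `A` among the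
parameters of a rule instance are replaced by a nested sequent `Θ`, at any depth, and the same is
done in the premises, the result is again an instance of the rule. So `Θ` can be put in place of `A`
throughout a cut-free derivation, except where `A` is principal
(`CutFreeDerivable.replace`). At such a place `A` stands at the top level of the sequent, as every
rule introduces its principal formula there.

To cut `Γ, A` with `Δ, Ā`, one replaces `A` by `Δ` in the derivation of `Γ, A`. Where
`A` is introduced, next to a context `Γ'`, one replaces `Ā` by `Γ'` in the derivation of `Δ, Ā`.
What remains are the cuts in which both cut formulae are principal
(`CutFreeDerivable.cut_of_principal_cut`). These reduce to cuts on immediate subformulae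
(`propositional_cut`, `modal_cut`); in the modal cases the rule `res` brings the subformula to the
top level and back. Induction on the cut formula (`CutFreeDerivable.cut`) finishes
the proof. The rules `ρ(S)` need no attention, because they have no principal formula and all of
their structures are parameters.
-/

namespace GrammarLogic

universe uL uA

variable {L : Type uL} {At : Type uA}

/-! ### Nested sequents as a free commutative monoid -/

namespace NSeq

theorem members_injective : Function.Injective (members : NSeq L At → _) :=
  (equivMultiset L At).injective

theorem item_injective : Function.Injective (item : _ → NSeq L At) := fun x y h => by
  have := congrArg members h
  rwa [members_item, members_item, Multiset.singleton_inj] at this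

theorem members_zero : members (0 : NSeq L At) = 0 := rfl

theorem item_ne_zero (x : Formula L At ⊕ (L × NSeq L At)) : item x ≠ 0 := fun h => by
  have := congrArg members h
  rw [members_item, members_zero] at this
  exact Multiset.singleton_ne_zero x this

theorem add_eq_zero {X Y : NSeq L At} (h : X + Y = 0) : X = 0 ∧ Y = 0 := by
  have h' := congrArg members h
  rw [members_add, members_zero, _root_.add_eq_zero] at h'
  exact ⟨members_injective h'.1, members_injective h'.2⟩

theorem add_eq_item {X Y : NSeq L At} {x : Formula L At ⊕ (L × NSeq L At)}
    (h : X + Y = item x) : (X = 0 ∧ Y = item x) ∨ (X = item x ∧ Y = 0) := by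
  have h' := congrArg members h
  rw [members_add, members_item] at h'
  rcases Multiset.empty_or_exists_mem (members X) with hX | ⟨y, hy⟩
  · obtain rfl : X = 0 := members_injective hX
    exact .inl ⟨rfl, by rwa [zero_add] at h⟩
  · obtain ⟨M, hM⟩ := Multiset.exists_cons_of_mem hy
    rw [hM, Multiset.cons_add, eq_comm, Multiset.singleton_eq_cons_iff,
      _root_.add_eq_zero] at h'
    obtain rfl : Y = 0 := members_injective h'.2.2
    exact .inr ⟨by rwa [add_zero] at h, rfl⟩

/-- The Riesz refinement property: two decompositions of a nested sequent into two parts have a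
common refinement. -/
theorem exists_refinement {X Y Z W : NSeq L At} (h : X + Y = Z + W) :
    ∃ P Q R T : NSeq L At, X = P + Q ∧ Y = R + T ∧ Z = P + R ∧ W = Q + T := by
  classical
  obtain ⟨X, rfl⟩ := (equivMultiset L At).symm.surjective X
  obtain ⟨Y, rfl⟩ := (equivMultiset L At).symm.surjective Y
  obtain ⟨Z, rfl⟩ := (equivMultiset L At).symm.surjective Z
  obtain ⟨W, rfl⟩ := (equivMultiset L At).symm.surjective W
  have symm_add (M N : Multiset (Formula L At ⊕ (L × NSeq L At))) :
      (equivMultiset L At).symm (M + N)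
        = (equivMultiset L At).symm M + (equivMultiset L At).symm N := by
    simp [equivMultiset]
  rw [← symm_add, ← symm_add, EmbeddingLike.apply_eq_iff_eq] at h
  refine ⟨(equivMultiset L At).symm (X ∩ Z), (equivMultiset L At).symm (X - Z),
    (equivMultiset L At).symm (Z - X), (equivMultiset L At).symm (W - (X - Z)), ?_⟩
  simp only [← symm_add, EmbeddingLike.apply_eq_iff_eq]
  refine ⟨?_, ?_, ?_, ?_⟩ <;> ext x <;> have := congrArg (Multiset.count x) h <;>
    simp only [Multiset.count_add, Multiset.count_sub, Multiset.count_inter] at this ⊢ <;> omega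

end NSeq

open NSeq

/-! ### Replacing occurrences of a formula -/

/-- `Replace A Θ X Y`: the nested sequent `Y` arises from `X` by replacing some occurrences of the
formula `A`, at any depth, by `Θ`. Occurrences inside larger formulae do not count. -/
inductive Replace (A : Formula L At) (Θ : NSeq L At) : NSeq L At → NSeq L At → Prop
  | refl (X : NSeq L At) : Replace A Θ X X
  | hit : Replace A Θ (fml A) Θ
  | add {X X' Y Y' : NSeq L At} :
      Replace A Θ X X' → Replace A Θ Y Y' → Replace A Θ (X + Y) (X' + Y')
  | node (a : L) {X X' : NSeq L At} : Replace A Θ X X' → Replace A Θ (node a X) (node a X')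

namespace Replace

variable {A : Formula L At} {Θ : NSeq L At}

theorem of_zero {X Z : NSeq L At} (h : Replace A Θ X Z) (hX : X = 0) : Z = 0 := by
  induction h with
  | refl => exact hX
  | hit => exact absurd hX (item_ne_zero (.inl A))
  | add _ _ ih ih' =>
    obtain ⟨h, h'⟩ := add_eq_zero hX
    rw [ih h, ih' h', add_zero]
  | node a _ _ => exact absurd hX (item_ne_zero (.inr (a, _)))

theorem of_add {X Y Z : NSeq L At} (h : Replace A Θ (X + Y) Z) :
    ∃ X' Y', Z = X' + Y' ∧ Replace A Θ X X' ∧ Replace A Θ Y Y' := by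
  -- The case of a sequent with a single member: one of the two parts is empty.
  have single {x : Formula L At ⊕ (L × NSeq L At)} {X Y Z : NSeq L At}
      (hx : X + Y = item x) (h : Replace A Θ (item x) Z) :
      ∃ X' Y', Z = X' + Y' ∧ Replace A Θ X X' ∧ Replace A Θ Y Y' := by
    rcases add_eq_item hx with ⟨rfl, rfl⟩ | ⟨rfl, rfl⟩
    · exact ⟨0, Z, (zero_add Z).symm, .refl 0, h⟩
    · exact ⟨Z, 0, (add_zero Z).symm, h, .refl 0⟩
  generalize hW : X + Y = W at h
  induction h generalizing X Y with
  | refl => exact ⟨X, Y, hW.symm, .refl X, .refl Y⟩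
  | hit => exact single (x := .inl A) hW .hit
  | add _ _ ih ih' =>
    obtain ⟨P, Q, R, T, rfl, rfl, rfl, rfl⟩ := exists_refinement hW
    obtain ⟨P', R', rfl, hP, hR⟩ := ih rfl
    obtain ⟨Q', T', rfl, hQ, hT⟩ := ih' rfl
    exact ⟨P' + Q', R' + T', add_add_add_comm .., hP.add hQ, hR.add hT⟩
  | node a h _ => exact single (x := .inr (a, _)) hW (.node a h)

theorem of_item {x : Formula L At ⊕ (L × NSeq L At)} {Z : NSeq L At}
    (h : Replace A Θ (item x) Z) :
    Z = item x ∨ (x = .inl A ∧ Z = Θ) ∨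
      ∃ a X X', x = .inr (a, X) ∧ Z = NSeq.node a X' ∧ Replace A Θ X X' := by
  generalize hW : item x = W at h
  induction h with
  | refl => exact .inl rfl
  | hit => exact .inr (.inl ⟨item_injective (a₂ := .inl A) hW, rfl⟩)
  | add h h' ih ih' =>
    rcases add_eq_item hW.symm with ⟨rfl, rfl⟩ | ⟨rfl, rfl⟩
    · rw [h.of_zero rfl, zero_add, zero_add]; exact ih' rfl
    · rw [h'.of_zero rfl, add_zero, add_zero]; exact ih rfl
  | node a h _ =>
    exact .inr (.inr ⟨a, _, _, item_injective (a₂ := .inr (a, _)) hW, rfl, h⟩)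

theorem of_fml {B : Formula L At} {Z : NSeq L At} (h : Replace A Θ (fml B) Z) :
    Z = fml B ∨ (B = A ∧ Z = Θ) := by
  rcases of_item (x := .inl B) h with h | ⟨h, hZ⟩ | ⟨_, _, _, h, _⟩
  · exact .inl h
  · exact .inr ⟨Sum.inl_injective h, hZ⟩
  · exact absurd h Sum.inl_ne_inr

theorem of_node {a : L} {X Z : NSeq L At} (h : Replace A Θ (NSeq.node a X) Z) :
    ∃ X', Z = NSeq.node a X' ∧ Replace A Θ X X' := by
  rcases of_item (x := .inr (a, X)) h with h | ⟨h, _⟩ | ⟨_, _, X', h, hZ, hX⟩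
  · exact ⟨X, h, .refl X⟩
  · exact absurd h Sum.inr_ne_inl
  · cases h
    exact ⟨X', hZ, hX⟩

theorem nodeWord (u : List L) {X X' : NSeq L At} (h : Replace A Θ X X') :
    Replace A Θ (NSeq.nodeWord u X) (NSeq.nodeWord u X') := by
  induction u with
  | nil => exact h
  | cons a u ih => exact .node a ih

theorem of_nodeWord {u : List L} {X Z : NSeq L At} (h : Replace A Θ (NSeq.nodeWord u X) Z) :
    ∃ X', Z = NSeq.nodeWord u X' ∧ Replace A Θ X X' := by
  induction u generalizing Z with
  | nil => exact ⟨Z, rfl, h⟩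
  | cons a u ih =>
    obtain ⟨Z', rfl, h'⟩ := of_node (show Replace A Θ (NSeq.node a (NSeq.nodeWord u X)) Z from h)
    obtain ⟨X', rfl, hX⟩ := ih h'
    exact ⟨X', rfl, hX⟩

end Replace

/-! ### Cut-free derivability -/

variable [ConverseAlphabet L] {S : SemiThue L}

/-- Derivability in `SKm(S)` without the cut rule, as a proposition. -/
inductive CutFreeDerivable (S : SemiThue L) : NSeq L At → Prop
  | id (Γ : NSeq L At) (p : At) : CutFreeDerivable S (Γ + fml (.atom p) + fml (.natom p))
  | ctr (Γ Δ : NSeq L At) : CutFreeDerivable S (Γ + Δ + Δ) → CutFreeDerivable S (Γ + Δ)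
  | wk (Γ Δ : NSeq L At) : CutFreeDerivable S Γ → CutFreeDerivable S (Γ + Δ)
  | res (Γ Δ : NSeq L At) (a : L) :
      CutFreeDerivable S (Γ + node a Δ) →
        CutFreeDerivable S (node (ConverseAlphabet.conv a) Γ + Δ)
  | and (Γ : NSeq L At) (A B : Formula L At) :
      CutFreeDerivable S (Γ + fml A) → CutFreeDerivable S (Γ + fml B) →
        CutFreeDerivable S (Γ + fml (.and A B))
  | or (Γ : NSeq L At) (A B : Formula L At) :
      CutFreeDerivable S (Γ + fml A + fml B) → CutFreeDerivable S (Γ + fml (.or A B))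
  | box (Γ : NSeq L At) (a : L) (A : Formula L At) :
      CutFreeDerivable S (Γ + node a (fml A)) → CutFreeDerivable S (Γ + fml (.box a A))
  | dia (Γ Δ : NSeq L At) (a : L) (A : Formula L At) :
      CutFreeDerivable S (Γ + node a (Δ + fml A)) →
        CutFreeDerivable S (Γ + node a Δ + fml (.dia a A))
  | rho (Γ Δ : NSeq L At) (u v : List L) (h : (u, v) ∈ S) :
      CutFreeDerivable S (nodeWord u Δ + Γ) → CutFreeDerivable S (nodeWord v Δ + Γ)

/-- `Introduces S A Γ`: some rule other than cut has an instance with conclusion `Γ, A`, principal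
formula `A`, and cut-free derivable premises. -/
def Introduces (S : SemiThue L) : Formula L At → NSeq L At → Prop
  | .atom p, Γ => ∃ Γ₀, Γ = Γ₀ + fml (.natom p)
  | .natom p, Γ => ∃ Γ₀, Γ = Γ₀ + fml (.atom p)
  | .or A B, Γ => CutFreeDerivable S (Γ + fml A + fml B)
  | .and A B, Γ => CutFreeDerivable S (Γ + fml A) ∧ CutFreeDerivable S (Γ + fml B)
  | .box a A, Γ => CutFreeDerivable S (Γ + node a (fml A))
  | .dia a A, Γ =>
      ∃ Γ₀ Δ, Γ = Γ₀ + node a Δ ∧ CutFreeDerivable S (Γ₀ + node a (Δ + fml A))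

namespace CutFreeDerivable

theorem exists_cutFree {Γ : NSeq L At} (h : CutFreeDerivable S Γ) :
    ∃ d : SKm S Γ, d.CutFree := by
  induction h with
  | id Γ p => exact ⟨.id Γ p, trivial⟩
  | ctr Γ Δ _ ih => exact ih.elim fun d hd => ⟨.ctr Γ Δ d, hd⟩
  | wk Γ Δ _ ih => exact ih.elim fun d hd => ⟨.wk Γ Δ d, hd⟩
  | res Γ Δ a _ ih => exact ih.elim fun d hd => ⟨.res Γ Δ a d, hd⟩
  | and Γ A B _ _ ih ih' =>
    exact ih.elim fun d hd => ih'.elim fun e he => ⟨.and Γ A B d e, hd, he⟩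
  | or Γ A B _ ih => exact ih.elim fun d hd => ⟨.or Γ A B d, hd⟩
  | box Γ a A _ ih => exact ih.elim fun d hd => ⟨.box Γ a A d, hd⟩
  | dia Γ Δ a A _ ih => exact ih.elim fun d hd => ⟨.dia Γ Δ a A d, hd⟩
  | rho Γ Δ u v h _ ih => exact ih.elim fun d hd => ⟨.rho Γ Δ u v h d, hd⟩

/-- If `Θ` can take the place of `A` wherever `A` is principal, it can do so everywhere. -/
theorem replace {A : Formula L At} {Θ : NSeq L At}
    (hA : ∀ Γ, Introduces S A Γ → CutFreeDerivable S (Γ + Θ))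
    {X Y : NSeq L At} (hX : CutFreeDerivable S X) (hXY : Replace A Θ X Y) :
    CutFreeDerivable S Y := by
  induction hX generalizing Y with
  | id Γ p =>
    obtain ⟨Z, P, rfl, h, hP⟩ := hXY.of_add
    obtain ⟨Γ', N, rfl, -, hN⟩ := h.of_add
    rcases hN.of_fml with rfl | ⟨rfl, rfl⟩
    · rcases hP.of_fml with rfl | ⟨rfl, rfl⟩
      · exact .id Γ' p
      · exact hA _ ⟨Γ', rfl⟩
    · rcases hP.of_fml with rfl | ⟨h, -⟩
      · rw [add_right_comm]
        exact hA _ ⟨Γ', rfl⟩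
      · cases h
  | ctr Γ Δ _ ih =>
    obtain ⟨Γ', Δ', rfl, hΓ, hΔ⟩ := hXY.of_add
    exact .ctr Γ' Δ' (ih ((hΓ.add hΔ).add hΔ))
  | wk Γ Δ _ ih =>
    obtain ⟨Γ', Δ', rfl, hΓ, -⟩ := hXY.of_add
    exact .wk Γ' Δ' (ih hΓ)
  | res Γ Δ a _ ih =>
    obtain ⟨N, Δ', rfl, hN, hΔ⟩ := hXY.of_add
    obtain ⟨Γ', rfl, hΓ⟩ := hN.of_node
    exact .res Γ' Δ' a (ih (hΓ.add (.node a hΔ)))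
  | and Γ B C _ _ ih ih' =>
    obtain ⟨Γ', P, rfl, hΓ, hP⟩ := hXY.of_add
    have hB := ih (hΓ.add (.refl _))
    have hC := ih' (hΓ.add (.refl _))
    rcases hP.of_fml with rfl | ⟨rfl, rfl⟩
    · exact .and Γ' B C hB hC
    · exact hA Γ' ⟨hB, hC⟩
  | or Γ B C _ ih =>
    obtain ⟨Γ', P, rfl, hΓ, hP⟩ := hXY.of_add
    have hBC := ih ((hΓ.add (.refl _)).add (.refl _))
    rcases hP.of_fml with rfl | ⟨rfl, rfl⟩
    · exact .or Γ' B C hBC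
    · exact hA Γ' hBC
  | box Γ a B _ ih =>
    obtain ⟨Γ', P, rfl, hΓ, hP⟩ := hXY.of_add
    have hB := ih (hΓ.add (.refl _))
    rcases hP.of_fml with rfl | ⟨rfl, rfl⟩
    · exact .box Γ' a B hB
    · exact hA Γ' hB
  | dia Γ Δ a B _ ih =>
    obtain ⟨Z, P, rfl, h, hP⟩ := hXY.of_add
    obtain ⟨Γ', N, rfl, hΓ, hN⟩ := h.of_add
    obtain ⟨Δ', rfl, hΔ⟩ := hN.of_node
    have hB := ih (hΓ.add (.node a (hΔ.add (.refl _))))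
    rcases hP.of_fml with rfl | ⟨rfl, rfl⟩
    · exact .dia Γ' Δ' a B hB
    · exact hA _ ⟨Γ', Δ', rfl, hB⟩
  | rho Γ Δ u v h _ ih =>
    obtain ⟨N, Γ', rfl, hN, hΓ⟩ := hXY.of_add
    obtain ⟨Δ', rfl, hΔ⟩ := hN.of_nodeWord
    exact .rho Γ' Δ' u v h (ih ((hΔ.nodeWord u).add hΓ))

/-! ### Admissibility of cut -/

/-- The rule `res` read backwards: it moves a structure under the converse label, and the
converse is an involution. -/
theorem res_symm {Γ Δ : NSeq L At} {a : L}
    (h : CutFreeDerivable S (node (ConverseAlphabet.conv a) Γ + Δ)) :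
    CutFreeDerivable S (Γ + node a Δ) := by
  rw [add_comm] at h ⊢
  simpa only [ConverseAlphabet.conv_conv] using res Δ Γ (ConverseAlphabet.conv a) h

/-- The reduction of a principal cut on `[a]A` and `⟨a⟩Ā` to a cut on `A` and `Ā`. The formulae
`A` and `B` are kept independent here, so that it serves for either order of the premises. -/
theorem modal_cut {A B : Formula L At}
    (cut : ∀ Γ Δ : NSeq L At, CutFreeDerivable S (Γ + fml A) → CutFreeDerivable S (Δ + fml B) →
      CutFreeDerivable S (Γ + Δ))
    {Γ Δ Θ : NSeq L At} {a : L} (hA : CutFreeDerivable S (Γ + node a (fml A)))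
    (hB : CutFreeDerivable S (Δ + node a (Θ + fml B))) :
    CutFreeDerivable S (Γ + (Δ + node a Θ)) := by
  -- Both premises get the same context `Γ + Δ`, so that after the cut the two copies of
  -- `ā{Γ, Δ}` can be contracted.
  have hA' := res (Γ + Δ) _ a (add_right_comm Γ _ Δ ▸ hA.wk _ Δ)
  have hB' := res (Γ + Δ) _ a <| by
    rw [add_comm Γ, add_right_comm]
    exact hB.wk _ Γ
  rw [← add_assoc] at hB' ⊢
  have h := cut _ _ hA' hB'
  apply res_symm
  rw [add_comm]
  apply ctr
  rwa [add_assoc, add_comm, add_assoc]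

/-- The reduction of a principal cut on `A ∧ B` and `Ā ∨ B̄`, where `A'` and `B'` stand for `Ā`
and `B̄` and are left arbitrary so that either side of the cut may be the conjunction. -/
theorem propositional_cut {A A' B B' : Formula L At}
    (cutA : ∀ Γ Δ : NSeq L At, CutFreeDerivable S (Γ + fml A) → CutFreeDerivable S (Δ + fml A') →
      CutFreeDerivable S (Γ + Δ))
    (cutB : ∀ Γ Δ : NSeq L At, CutFreeDerivable S (Γ + fml B) → CutFreeDerivable S (Δ + fml B') →
      CutFreeDerivable S (Γ + Δ))
    {Γ Δ : NSeq L At} (hA : CutFreeDerivable S (Γ + fml A)) (hB : CutFreeDerivable S (Γ + fml B))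
    (hAB : CutFreeDerivable S (Δ + fml A' + fml B')) : CutFreeDerivable S (Γ + Δ) := by
  have h := cutB _ (Γ + Δ) hB (add_assoc Γ Δ _ ▸ cutA _ _ hA (add_right_comm Δ _ _ ▸ hAB))
  rw [add_comm]
  apply ctr
  rwa [add_assoc, add_comm, add_assoc]

/-- Cuts reduce to cuts in which both cut formulae are principal. -/
theorem cut_of_principal_cut {A B : Formula L At}
    (h : ∀ Γ Δ : NSeq L At, Introduces S A Γ → Introduces S B Δ → CutFreeDerivable S (Γ + Δ))
    (Γ Δ : NSeq L At) (hΓ : CutFreeDerivable S (Γ + fml A))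
    (hΔ : CutFreeDerivable S (Δ + fml B)) : CutFreeDerivable S (Γ + Δ) := by
  refine hΓ.replace (fun Γ' hΓ' => ?_) ((Replace.refl Γ).add .hit)
  rw [add_comm]
  refine hΔ.replace (fun Δ' hΔ' => ?_) ((Replace.refl Δ).add .hit)
  rw [add_comm]
  exact h Γ' Δ' hΓ' hΔ'

/-- Cut is admissible in the calculus without cut. -/
theorem cut (A : Formula L At) (Γ Δ : NSeq L At) (hΓ : CutFreeDerivable S (Γ + fml A))
    (hΔ : CutFreeDerivable S (Δ + fml A.neg)) : CutFreeDerivable S (Γ + Δ) := by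
  induction A generalizing Γ Δ with
  | atom p =>
    refine cut_of_principal_cut ?_ Γ Δ hΓ hΔ
    rintro _ _ ⟨Γ, rfl⟩ ⟨Δ, rfl⟩
    rw [add_comm, add_add_add_comm, ← add_assoc]
    exact .id (Δ + Γ) p
  | natom p =>
    refine cut_of_principal_cut ?_ Γ Δ hΓ hΔ
    rintro _ _ ⟨Γ, rfl⟩ ⟨Δ, rfl⟩
    rw [add_add_add_comm, ← add_assoc]
    exact .id (Γ + Δ) p
  | or A B ihA ihB =>
    refine cut_of_principal_cut (fun Γ Δ hΓ hΔ => ?_) Γ Δ hΓ hΔ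
    rw [add_comm]
    exact propositional_cut (fun Γ Δ hΓ hΔ => add_comm Δ Γ ▸ ihA Δ Γ hΔ hΓ)
      (fun Γ Δ hΓ hΔ => add_comm Δ Γ ▸ ihB Δ Γ hΔ hΓ) hΔ.1 hΔ.2 hΓ
  | and A B ihA ihB =>
    refine cut_of_principal_cut (fun Γ Δ hΓ hΔ => ?_) Γ Δ hΓ hΔ
    exact propositional_cut ihA ihB hΓ.1 hΓ.2 hΔ
  | box a A ih =>
    refine cut_of_principal_cut ?_ Γ Δ hΓ hΔ
    rintro Γ _ hA ⟨Δ, Θ, rfl, hB⟩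
    exact modal_cut ih hA hB
  | dia a A ih =>
    refine cut_of_principal_cut ?_ Γ Δ hΓ hΔ
    rintro _ Δ ⟨Γ, Θ, rfl, hA⟩ hB
    rw [add_comm]
    exact modal_cut (fun Γ Δ hΓ hΔ => add_comm Δ Γ ▸ ih Δ Γ hΔ hΓ) hB hA

end CutFreeDerivable

theorem SKm.cutFreeDerivable {Γ : NSeq L At} (d : SKm S Γ) : CutFreeDerivable S Γ := by
  induction d with
  | id Γ p => exact .id Γ p
  | cut Γ Δ A _ _ ih ih' => exact .cut A Γ Δ ih ih'
  | ctr Γ Δ _ ih => exact .ctr Γ Δ ih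
  | wk Γ Δ _ ih => exact .wk Γ Δ ih
  | res Γ Δ a _ ih => exact .res Γ Δ a ih
  | and Γ A B _ _ ih ih' => exact .and Γ A B ih ih'
  | or Γ A B _ ih => exact .or Γ A B ih
  | box Γ a A _ ih => exact .box Γ a A ih
  | dia Γ Δ a A _ ih => exact .dia Γ Δ a A ih
  | rho Γ Δ u v h _ ih => exact .rho Γ Δ u v h ih

end GrammarLogic

theorem mainTheorem2 {L : Type*} [GrammarLogic.ConverseAlphabet L] {At : Type*}
    (S : GrammarLogic.SemiThue L) (hS : S.Closed) (Γ : GrammarLogic.NSeq L At)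
    (d : GrammarLogic.SKm S Γ) :
    ∃ d' : GrammarLogic.SKm S Γ, d'.CutFree :=
  d.cutFreeDerivable.exists_cutFree
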